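/- Let $K=(\mathcal V,\mathcal E)$ be a connected, locally finite graph without loops or multiple edges, where $\mathcal E\subset\mathcal V\times\mathcal V$ is the symmetric set of oriented edges $e=(e^-,e^+)$, and write $-e=(e^+,e^-)$. Suppose that $K$ has a finite subgraph $K_0=(\mathcal V_0,\mathcal E_0)$ whose complementary graph $K_0^c$ (its vertices are those in $\mathcal V\setminus\mathcal V_0$, its edges are the edges in $\mathcal E\setminus\mathcal E_0$ with both ends in $\mathcal V\setminus\mathcal V_0$) is the disjoint union of finitely many trees $T_1,\dots,T_k$, and that for each $i$ there is an integer $q_i\ge 3$ such that either every vertex of $T_i$ has valence $q_i$ in $T_i$, or every vertex of $T_i$ has valence $q_i$ in $K$. Put all weights on vertices and edges equal to $1$, so that $L_2(\mathcal V)$ is the space of square summable real functions on $\mathcal V$ with $\langle f,g\rangle=\sum_{v}f(v)g(v)$, and $L_2(\mathcal E)$ is the space of square summable real functions $\varphi$ on $\mathcal E$ with $\varphi(-e)=-\varphi(e)$, with $\langle\varphi,\psi\rangle=\frac12\sum_{e\in\mathcal E}\varphi(e)\psi(e)$. For $f:\mathcal V\to\mathbb R$ let $df(e)=f(e^+)-f(e^-)$.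 Then: 1. $K$ is complete and homogeneous: there are a growing sequence $(B_n)_{n\in\mathbb N}$ of finite sets with union $\mathcal V$ and finitely supported functions $\chi_n:\mathcal V\to[0,1]$ with $\chi_n=1$ on $B_n$, such that for every $p$ there is $n_0$ with $d\chi_n(e)=0$ for all $n\ge n_0$ and all edges $e$ having at least one end in $B_p$, and such that for some $C>0$, for all $n\in\mathbb N$ and $x\in\mathcal V$, $$\sum_{e\in\mathcal E,\ e^+=x\text{ or }e^-=x}(d\chi_n(e))^2\le C.$$ 2. The image of the closure of the operator $d$, defined on the finitely supported functions, as an unbounded operator from $L_2(\mathcal V)$ to $L_2(\mathcal E)$, is closed in $L_2(\mathcal E)$. -/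

import Mathlib

open Filter Topology

noncomputable section

namespace WeightedGraph

/-! ### Weighted `ℓ²` spaces -/

/-- The real functions `f` on `α` with `∑ w(a) f(a)² < ∞`, for a positive weight `w`. -/
def l2Submodule {α : Type*} (w : α → ℝ) (hw : ∀ a, 0 < w a) : Submodule ℝ (α → ℝ) where
  carrier := {f | Summable fun a => w a * f a ^ 2}
  zero_mem' := by simp [summable_zero]
  add_mem' := by
    intro f g hf hg
    refine Summable.of_nonneg_of_le (fun a => ?_) (fun a => ?_)
      ((hf.mul_left 2).add (hg.mul_left 2))
    · exact mul_nonneg (hw a).le (sq_nonneg _)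
    · have := mul_nonneg (hw a).le (sq_nonneg (f a - g a))
      simp only [Pi.add_apply]
      nlinarith
  smul_mem' := by
    intro t f hf
    refine (hf.mul_left (t ^ 2)).congr fun a => ?_
    simp only [Pi.smul_apply, smul_eq_mul]
    ring

/-- The real Hilbert space of functions `f` on `α` with `∑ w(a) f(a)² < ∞`, with scalar product
`⟨f, g⟩ = ∑ w(a) f(a) g(a)`; it is the completion of the finitely supported functions. -/
def L2 {α : Type*} (w : α → ℝ) (hw : ∀ a, 0 < w a) : Type _ := l2Submodule w hw

namespace L2

variable {α : Type*} {w : α → ℝ} {hw : ∀ a, 0 < w a}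

instance : AddCommGroup (L2 w hw) := inferInstanceAs (AddCommGroup (l2Submodule w hw))

instance : Module ℝ (L2 w hw) := inferInstanceAs (Module ℝ (l2Submodule w hw))

instance : CoeFun (L2 w hw) (fun _ => α → ℝ) := ⟨fun f => f.1⟩

@[ext] theorem ext {f g : L2 w hw} (h : ∀ a, f a = g a) : f = g := Subtype.ext (funext h)

@[simp] theorem zero_apply (a : α) : (0 : L2 w hw) a = 0 := rfl

@[simp] theorem add_apply (f g : L2 w hw) (a : α) : (f + g) a = f a + g a := rfl

@[simp] theorem sub_apply (f g : L2 w hw) (a : α) : (f - g) a = f a - g a := rfl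

@[simp] theorem smul_apply (t : ℝ) (f : L2 w hw) (a : α) : (t • f) a = t * f a := rfl

theorem summable_sq (f : L2 w hw) : Summable fun a => w a * f a ^ 2 := f.2

theorem summable_mul (f g : L2 w hw) : Summable fun a => w a * (f a * g a) := by
  refine (((f + g).summable_sq.sub f.summable_sq).sub g.summable_sq).mul_left (1 / 2) |>.congr
    fun a => ?_
  simp only [add_apply]
  ring

instance : Inner ℝ (L2 w hw) := ⟨fun f g => ∑' a, w a * (f a * g a)⟩

theorem inner_def (f g : L2 w hw) : inner ℝ f g = ∑' a, w a * (f a * g a) := rfl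

/-- The scalar product `⟨f, g⟩ = ∑ w(a) f(a) g(a)`. -/
instance innerCore : InnerProductSpace.Core ℝ (L2 w hw) where
  inner f g := ∑' a, w a * (f a * g a)
  conj_inner_symm f g := by
    simp only [conj_trivial]
    exact tsum_congr fun a => by ring
  re_inner_nonneg f := by
    simp only [RCLike.re_to_real]
    exact tsum_nonneg fun a => mul_nonneg (hw a).le (mul_self_nonneg _)
  add_left f g h := by
    rw [← (summable_mul f h).tsum_add (summable_mul g h)]
    exact tsum_congr fun a => by simp only [add_apply]; ring
  smul_left f g t := by
    simp only [conj_trivial]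
    rw [← tsum_mul_left]
    exact tsum_congr fun a => by simp only [smul_apply]; ring
  definite f h := by
    ext a
    have h0 : ∀ a, 0 ≤ w a * (f a * f a) := fun a => mul_nonneg (hw a).le (mul_self_nonneg _)
    have h1 := ((summable_mul f f).hasSum_iff.2 h)
    have h2 := congrFun ((hasSum_zero_iff_of_nonneg h0).1 h1) a
    have h3 : f a * f a = 0 := (mul_eq_zero.1 h2).resolve_left (hw a).ne'
    simpa using h3

instance : NormedAddCommGroup (L2 w hw) := innerCore.toNormedAddCommGroup

instance : InnerProductSpace ℝ (L2 w hw) := InnerProductSpace.ofCore innerCore.toCore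

theorem norm_sq_eq (f : L2 w hw) : ‖f‖ ^ 2 = ∑' a, w a * f a ^ 2 := by
  rw [← real_inner_self_eq_norm_sq, inner_def]
  exact tsum_congr fun a => by ring

theorem continuous_apply (a : α) : Continuous fun f : L2 w hw => f a := by
  let ev : L2 w hw →ₗ[ℝ] ℝ :=
    { toFun := fun f => f a, map_add' := fun _ _ => rfl, map_smul' := fun _ _ => rfl }
  refine (ev.mkContinuous (Real.sqrt (w a))⁻¹ fun f => ?_).continuous
  have hs : 0 < Real.sqrt (w a) := Real.sqrt_pos.2 (hw a)
  rw [inv_mul_eq_div, le_div_iff₀ hs]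
  refine abs_le_of_sq_le_sq' ?_ (norm_nonneg _) |>.2
  rw [mul_pow, Real.sq_sqrt (hw a).le, norm_sq_eq, Real.norm_eq_abs, sq_abs, mul_comm]
  exact f.summable_sq.le_tsum a fun b _ => mul_nonneg (hw b).le (sq_nonneg _)

end L2

/-! ### Weighted graphs, cochains and the difference operator

The oriented edges of a graph are its darts `e`, with `e⁻ = e.fst`, `e⁺ = e.snd`, `-e = e.symm`. -/

/-- Positive weights on the vertices, and positive even weights on the oriented edges. -/
structure Weights {V : Type*} (G : SimpleGraph V) where
  c : V → ℝ
  c_pos : ∀ v, 0 < c v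
  r : G.Dart → ℝ
  r_pos : ∀ e, 0 < r e
  r_even : ∀ e, r e.symm = r e

variable {V : Type*} {G : SimpleGraph V}

/-- The weights constant equal to `1` on vertices and edges. -/
def Weights.one (G : SimpleGraph V) : Weights G where
  c _ := 1
  c_pos _ := one_pos
  r _ := 1
  r_pos _ := one_pos
  r_even _ := rfl

/-- The Hilbert space of `0`-cochains, with `⟨f, g⟩ = ∑ c(v) f(v) g(v)`. -/
abbrev L2V (W : Weights G) : Type _ := L2 W.c W.c_pos

/-- The square summable functions on oriented edges, with
`⟨φ, ψ⟩ = ½ ∑ r(e) φ(e) ψ(e)`, before the oddness condition. -/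
abbrev L2Dart (W : Weights G) : Type _ :=
  L2 (fun e => W.r e / 2) (fun e => half_pos (W.r_pos e))

/-- The Hilbert space of `1`-cochains: the odd functions, with
`⟨φ, ψ⟩ = ½ ∑ r(e) φ(e) ψ(e)`, the sum being over all oriented edges. -/
def L2E (W : Weights G) : Submodule ℝ (L2Dart W) where
  carrier := {φ | ∀ e : G.Dart, φ e.symm = -φ e}
  zero_mem' := fun e => by simp
  add_mem' := fun {φ ψ} hφ hψ e => by simp only [L2.add_apply, hφ e, hψ e]; ring
  smul_mem' := fun t φ hφ e => by simp only [L2.smul_apply, hφ e]; ring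

/-- The difference `(df)(e) = f(e⁺) - f(e⁻)`. -/
def diff (f : V → ℝ) (e : G.Dart) : ℝ := f e.snd - f e.fst

theorem finite_darts_at [G.LocallyFinite] (x : V) :
    {e : G.Dart | e.snd = x ∨ e.fst = x}.Finite := by
  classical
  have h : {e : G.Dart | e.fst = x}.Finite := by
    refine (Set.finite_range (G.dartOfNeighborSet x)).subset ?_
    rintro ⟨⟨u, v⟩, huv⟩ rfl
    exact ⟨⟨v, huv⟩, rfl⟩
  refine ((h.image SimpleGraph.Dart.symm).union h).subset ?_
  rintro e (he | he)
  · exact Or.inl ⟨e.symm, he, e.symm_symm⟩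
  · exact Or.inr he

theorem finite_support_diff [G.LocallyFinite] {f : V → ℝ} (hf : f.support.Finite) :
    (Function.support (diff (G := G) f)).Finite := by
  refine (hf.biUnion fun x _ => finite_darts_at (G := G) x).subset fun e he => ?_
  simp only [Set.mem_iUnion, Set.mem_ofPred_eq]
  by_cases h : f e.snd = 0
  · refine ⟨e.fst, fun h' => he ?_, Or.inr rfl⟩
    simp [diff, h, h']
  · exact ⟨e.snd, h, Or.inl rfl⟩

/-- The finitely supported `0`-cochains. -/
def C0 (W : Weights G) : Submodule ℝ (L2V W) where
  carrier := {f | (Function.support f).Finite}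
  zero_mem' := by
    have : Function.support (0 : L2V W) = ∅ := by ext; simp
    simp [this]
  add_mem' := fun {f g} hf hg =>
    (hf.union hg).subset fun a ha => by
      by_contra h
      simp only [Set.mem_union, Function.mem_support, not_or, not_not] at h
      exact ha (by simp [h.1, h.2])
  smul_mem' := fun t f hf => hf.subset fun a ha h => ha (by simp [h])

/-- The difference operator `d`, defined on the finitely supported `0`-cochains. -/
def d [G.LocallyFinite] (W : Weights G) : L2V W →ₗ.[ℝ] L2E W where
  domain := C0 W
  toFun :=
    { toFun := fun f =>
        ⟨⟨diff f.1, summable_of_hasFiniteSupport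
            ((finite_support_diff f.2).subset fun e he h => he (by simp [h]))⟩,
          fun e => by simp [diff]⟩
      map_add' := fun f g => by
        apply Subtype.ext
        ext e
        change (f.1 e.snd + g.1 e.snd) - (f.1 e.fst + g.1 e.fst) =
          (f.1 e.snd - f.1 e.fst) + (g.1 e.snd - g.1 e.fst)
        ring
      map_smul' := fun t f => by
        apply Subtype.ext
        ext e
        change t * f.1 e.snd - t * f.1 e.fst = t * (f.1 e.snd - f.1 e.fst)
        ring }

theorem d_apply [G.LocallyFinite] (W : Weights G) (f : (d W).domain) (e : G.Dart) :
    (d W f : L2Dart W) e = f.1 e.snd - f.1 e.fst := rfl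

theorem d_isClosable [G.LocallyFinite] (W : Weights G) : (d W).IsClosable := by
  refine ⟨(d W).graph.topologicalClosure.toLinearPMap, (Submodule.toLinearPMap_graph_eq _ ?_).symm⟩
  have hcl : IsClosed {p : L2V W × L2E W |
      ∀ e : G.Dart, (p.2 : L2Dart W) e = p.1 e.snd - p.1 e.fst} := by
    simp only [Set.ofPred_forall]
    refine isClosed_iInter fun e => isClosed_eq ?_ ?_
    · exact (L2.continuous_apply e).comp (continuous_subtype_val.comp continuous_snd)
    · exact ((L2.continuous_apply _).comp continuous_fst).sub
        ((L2.continuous_apply _).comp continuous_fst)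
  intro p hp hp0
  have := closure_minimal (s := ((d W).graph : Set (L2V W × L2E W))) (fun q hq => by
    obtain ⟨f, h1, h2⟩ := (LinearPMap.mem_graph_iff _).1 hq
    intro e
    rw [← h1, ← h2]
    rfl) hcl hp
  apply Subtype.ext
  ext e
  simpa [hp0] using this e

/-- The closure of the difference operator as an unbounded operator from `L2V` to `L2E`. -/
def dMin [G.LocallyFinite] (W : Weights G) : L2V W →ₗ.[ℝ] L2E W := (d W).closure

/-! ### Completeness and homogeneity -/

/-- `B` is a growing sequence of finite sets exhausting the vertices and `χ` is a related sequence
of cut-off functions. -/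
structure IsCutoff (G : SimpleGraph V) (B : ℕ → Finset V) (χ : ℕ → V → ℝ) : Prop where
  mono : Monotone B
  exhaust : ∀ v, ∃ n, v ∈ B n
  finite_support : ∀ n, (Function.support (χ n)).Finite
  nonneg : ∀ n v, 0 ≤ χ n v
  le_one : ∀ n v, χ n v ≤ 1
  eq_one : ∀ n, ∀ v ∈ B n, χ n v = 1
  diff_eq_zero : ∀ p, ∃ n₀, ∀ n ≥ n₀, ∀ e : G.Dart,
    (e.snd ∈ B p ∨ e.fst ∈ B p) → diff (χ n) e = 0

/-- Homogeneity of the weighted graph with respect to the cut-off functions `χ`. -/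
def IsHomogeneousFor [G.LocallyFinite] (W : Weights G) (χ : ℕ → V → ℝ) : Prop :=
  ∃ C > 0, ∀ n x,
    1 / W.c x * ∑ e ∈ (finite_darts_at (G := G) x).toFinset, W.r e * diff (χ n) e ^ 2 ≤ C

/-- The weighted graph is complete and homogeneous: the homogeneity condition holds for the
functions `χ` that occur in the completeness condition. -/
def IsCompleteHomogeneous [G.LocallyFinite] (W : Weights G) : Prop :=
  ∃ (B : ℕ → Finset V) (χ : ℕ → V → ℝ), IsCutoff G B χ ∧ IsHomogeneousFor W χ

/-! ### Complementary graphs and trees of constant valence -/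

/-- The complementary graph of a subgraph: the vertices outside `K₀`, with the edges outside `K₀`
both ends of which lie outside `K₀`. -/
def complementary (K₀ : G.Subgraph) : G.Subgraph where
  verts := K₀.vertsᶜ
  Adj u v := G.Adj u v ∧ ¬ K₀.Adj u v ∧ u ∈ K₀.vertsᶜ ∧ v ∈ K₀.vertsᶜ
  adj_sub h := h.1
  edge_vert h := h.2.2.1
  symm := ⟨fun _ _ h => ⟨h.1.symm, fun h' => h.2.1 h'.symm, h.2.2.2, h.2.2.1⟩⟩

/-- All vertices of the subgraph `T` of `G` have the same valence `q`, either counted in `T` or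
counted in the ambient graph `G`. -/
def HasConstantValence (T : G.Subgraph) (q : ℕ) : Prop :=
  (∀ v ∈ T.verts, (T.neighborSet v).ncard = q) ∨ (∀ v ∈ T.verts, (G.neighborSet v).ncard = q)

/-- `H` is the disjoint union of finitely many trees, each with a constant valence at least `3`
(which may depend on the tree). -/
def IsFiniteUnionOfTrees (H : G.Subgraph) : Prop :=
  ∃ (k : ℕ) (T : Fin k → G.Subgraph),
    (∀ i j, i ≠ j → Disjoint (T i).verts (T j).verts) ∧
    (∀ i, (T i).coe.IsTree ∧ ∃ q ≥ 3, HasConstantValence (T i) q) ∧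
    H = ⨆ i, T i

end WeightedGraph

end

/-! Let `F` consist of `K₀` and its neighbours, a finite set. A vertex outside `F` lies in one tree
with all its edges of `G`, so its two valences agree and equal some `q i ≥ 3`. Hence valences are
bounded, and indicators of a ball-like exhaustion serve as cut-offs. For the range, root each tree:
every vertex outside `F` has at least two children, and no vertex is a child twice. If `f` vanishes
on `F`, summing `f(u)²` over pairs (vertex, child) gives `2‖f‖²`, while summing the squares at the
children gives at most `‖f‖²`. The gap must be paid by `df`, so `‖f‖ ≤ 4‖df‖`
(`norm_le_of_children`). Vanishing on `F` is finitely many linear conditions, so a closed operator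
bounded below there has closed range. -/

namespace SimpleGraph

variable {V : Type*} {G : SimpleGraph V}

/-! ### Rooted trees and exhaustions -/

/-- In a tree, a vertex has at most one neighbour closer to a given root. -/
theorem IsTree.eq_of_adj_of_dist_add_one_eq (hG : G.IsTree) {r u v w : V}
    (hu : G.Adj u w) (hv : G.Adj v w) (hdu : G.dist r u + 1 = G.dist r w)
    (hdv : G.dist r v + 1 = G.dist r w) : u = v := by
  obtain ⟨p, hp⟩ := hG.connected.exists_walk_length_eq_dist r u
  obtain ⟨q, hq⟩ := hG.connected.exists_walk_length_eq_dist r v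
  -- Geodesics to `u` and `v` prolonged to `w` are still geodesics, hence both are the unique path
  -- from `r` to `w`.
  have hp' : (p.concat hu).IsPath := Walk.isPath_of_length_eq_dist _ (by simp [hp, hdu])
  have hq' : (q.concat hv).IsPath := Walk.isPath_of_length_eq_dist _ (by simp [hq, hdv])
  have h := (hG.existsUnique_path r w).unique hp' hq'
  simpa using congrArg Walk.penultimate h

/-- In a tree, every vertex of valence at least `3` has two children, where vertices with a common
child are equal. -/
theorem IsTree.exists_children (hG : G.IsTree) :
    ∃ c : V → Bool → V, (∀ u, 3 ≤ (G.neighborSet u).ncard →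
      (∀ b, G.Adj u (c u b)) ∧ c u true ≠ c u false) ∧
      ∀ u v a b, 3 ≤ (G.neighborSet u).ncard → 3 ≤ (G.neighborSet v).ncard →
        c u a = c v b → u = v := by
  obtain ⟨r⟩ := hG.connected.nonempty
  have key : ∀ u, ∃ c : Bool → V, 3 ≤ (G.neighborSet u).ncard →
      c true ≠ c false ∧ ∀ b, G.Adj u (c b) ∧ G.dist r u + 1 = G.dist r (c b) := by
    intro u
    by_cases h : 3 ≤ (G.neighborSet u).ncard
    swap
    · exact ⟨fun _ => u, fun h' => absurd h' h⟩
    obtain ⟨x, y, z, hx, hy, hz, hxy, hxz, hyz⟩ :=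
      (Set.two_lt_ncard_iff (Set.finite_of_ncard_ne_zero (by omega))).1 h
    rw [mem_neighborSet] at hx hy hz
    have aux : ∀ s t, G.Adj u s → G.Adj u t → s ≠ t → G.dist r u + 1 = G.dist r s →
        G.dist r u + 1 = G.dist r t → ∃ c : Bool → V, 3 ≤ (G.neighborSet u).ncard →
        c true ≠ c false ∧ ∀ b, G.Adj u (c b) ∧ G.dist r u + 1 = G.dist r (c b) :=
      fun s t hs ht hst hds hdt => ⟨fun b => if b then s else t, fun _ => ⟨by simpa using hst,
        Bool.forall_bool.2 ⟨⟨ht, hdt⟩, ⟨hs, hds⟩⟩⟩⟩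
    -- At most one neighbour of `u` is its parent, so among three neighbours at least two are
    -- farther from `r`.
    have up : ∀ s t, G.Adj u s → G.Adj u t → s ≠ t →
        G.dist r u + 1 = G.dist r s ∨ G.dist r u + 1 = G.dist r t := by
      intro s t hs ht hst
      by_contra! hc
      have h1 := hG.dist_eq_dist_add_one_of_adj r hs
      have h2 := hG.dist_eq_dist_add_one_of_adj r ht
      exact hst (hG.eq_of_adj_of_dist_add_one_eq hs.symm ht.symm (r := r) (by omega) (by omega))
    rcases up x y hx hy hxy with h1 | h1
    · rcases up y z hy hz hyz with h2 | h2
      · exact aux _ _ hx hy hxy h1 h2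
      · exact aux _ _ hx hz hxz h1 h2
    · rcases up x z hx hz hxz with h2 | h2
      · exact aux _ _ hx hy hxy h2 h1
      · exact aux _ _ hy hz hyz h1 h2
  choose c hc using key
  refine ⟨c, fun u hu => ⟨fun b => ((hc u hu).2 b).1, (hc u hu).1⟩, fun u v a b hu hv h => ?_⟩
  have h1 := (hc u hu).2 a
  have h2 := (hc v hv).2 b
  rw [← h] at h2
  exact hG.eq_of_adj_of_dist_add_one_eq h1.1 h2.1 h1.2 h2.2

/-- A growing sequence of finite sets, each containing the neighbours of the preceding one, that
exhausts a connected locally finite graph. -/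
theorem Connected.exists_exhaustion [G.LocallyFinite] (hG : G.Connected) :
    ∃ B : ℕ → Finset V, Monotone B ∧ (∀ v, ∃ n, v ∈ B n) ∧
      ∀ n u v, u ∈ B n → G.Adj u v → v ∈ B (n + 1) := by
  classical
  obtain ⟨r⟩ := hG.nonempty
  let B : ℕ → Finset V := fun n =>
    Nat.rec {r} (fun _ S => S ∪ S.biUnion fun u => G.neighborFinset u) n
  have hB : ∀ n, B (n + 1) = B n ∪ (B n).biUnion fun u => G.neighborFinset u := fun _ => rfl
  have hstep : ∀ n u v, u ∈ B n → G.Adj u v → v ∈ B (n + 1) := fun n u v hu huv => by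
    rw [hB]
    exact Finset.mem_union_right _ (Finset.mem_biUnion.2 ⟨u, hu, by simpa using huv⟩)
  refine ⟨B, monotone_nat_of_le_succ fun n => ?_, fun v => ?_, hstep⟩
  · rw [hB]
    exact Finset.subset_union_left
  · have h := (reachable_iff_reflTransGen r v).1 (hG r v)
    induction h with
    | refl => exact ⟨0, Finset.mem_singleton_self r⟩
    | tail _ huv ih =>
      obtain ⟨n, hn⟩ := ih
      exact ⟨n + 1, hstep n _ _ hn huv⟩

end SimpleGraph

/-! ### A closed range criterion -/

/-- A closed operator between Banach spaces that is bounded below on the part of its domain where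
finitely many continuous linear forms vanish has closed range. -/
theorem LinearPMap.IsClosed.isClosed_range_of_norm_le {E F ι : Type*} [NormedAddCommGroup E]
    [NormedSpace ℝ E] [CompleteSpace E] [NormedAddCommGroup F] [NormedSpace ℝ F] [CompleteSpace F]
    [Finite ι] {A : E →ₗ.[ℝ] F} (hA : A.IsClosed) (ev : E →L[ℝ] (ι → ℝ)) {C : ℝ}
    (hC : ∀ x : A.domain, ev x = 0 → ‖(x : E)‖ ≤ C * ‖A x‖) : _root_.IsClosed (Set.range A) := by
  have : CompleteSpace A.graph := IsClosed.completeSpace_coe (hs := hA)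
  let ev' : A.graph →L[ℝ] (ι → ℝ) :=
    ev.comp ((ContinuousLinearMap.fst ℝ E F).comp A.graph.subtypeL)
  let π : A.graph →L[ℝ] F := (ContinuousLinearMap.snd ℝ E F).comp A.graph.subtypeL
  let N : Submodule ℝ A.graph := LinearMap.ker (ev' : A.graph →ₗ[ℝ] (ι → ℝ))
  have hN : _root_.IsClosed (N : Set A.graph) := ev'.isClosed_ker
  have : CompleteSpace N := hN.completeSpace_coe
  have : N.CoFG := Submodule.CoFG.ker _
  have hmap : _root_.IsClosed (N.map (π : A.graph →ₗ[ℝ] F) : Set F) := by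
    let ρ : N →L[ℝ] F := π.comp N.subtypeL
    -- The graph carries the sup norm of `(x, A x)`; on `N` it is controlled by `‖A x‖` through `C`
    -- in the first coordinate and `1` in the second.
    have hρ : AntilipschitzWith (max C 1).toNNReal ρ := by
      refine AddMonoidHomClass.antilipschitz_of_bound ρ fun p => ?_
      obtain ⟨⟨p, hp⟩, hpe⟩ := p
      obtain ⟨x, hx1, hx2⟩ := (LinearPMap.mem_graph_iff _).1 hp
      have h := hC x (by rw [hx1]; exact LinearMap.mem_ker.1 hpe)
      rw [hx1, hx2] at h
      have hp2 : ‖p‖ ≤ max C 1 * ‖p.2‖ := by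
        rw [Prod.norm_def]
        exact max_le (h.trans (mul_le_mul_of_nonneg_right (le_max_left _ _) (norm_nonneg _)))
          (le_mul_of_one_le_left (norm_nonneg _) (le_max_right _ _))
      rw [Real.coe_toNNReal _ (le_max_of_le_right zero_le_one)]
      exact hp2
    have heq : (N.map (π : A.graph →ₗ[ℝ] F) : Set F) = Set.range ρ := by
      rw [Submodule.map_coe, Set.image_eq_range]
      rfl
    rw [heq]
    refine hρ.isClosed_range ?_
    exact uniformContinuous_snd.comp
      (uniformContinuous_subtype_val.comp uniformContinuous_subtype_val)
  -- `N` has finite codimension in the graph, so the range of `π` is a closed subspace plus a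
  -- finite-dimensional one.
  have hrange := LinearMap.isClosed_range_of_isClosed_map_of_finiteDimensional_quotient hmap
  have heq : Set.range A = (LinearMap.range (π : A.graph →ₗ[ℝ] F) : Set F) := by
    refine Set.ext fun y => ⟨?_, ?_⟩
    · rintro ⟨x, rfl⟩
      exact ⟨⟨_, A.mem_graph x⟩, rfl⟩
    · rintro ⟨⟨p, hp⟩, rfl⟩
      obtain ⟨x, -, hx⟩ := (LinearPMap.mem_graph_iff _).1 hp
      exact ⟨x, hx⟩
  rwa [heq]

namespace WeightedGraph

variable {V : Type*} {G : SimpleGraph V}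

/-! ### Graphs of bounded valence are complete and homogeneous -/

theorem card_darts_at_le [G.LocallyFinite] (x : V) :
    (finite_darts_at (G := G) x).toFinset.card ≤ 2 * (G.neighborSet x).ncard := by
  classical
  have h : (finite_darts_at (G := G) x).toFinset ⊆
      Finset.univ.image (G.dartOfNeighborSet x) ∪
        Finset.univ.image fun v => (G.dartOfNeighborSet x v).symm := by
    rintro ⟨⟨u, v⟩, huv⟩ he
    simp only [Set.Finite.mem_toFinset, Set.mem_ofPred_eq] at he
    rcases he with rfl | rfl
    · exact Finset.mem_union_right _ (Finset.mem_image.2 ⟨⟨u, huv.symm⟩, Finset.mem_univ _, rfl⟩)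
    · exact Finset.mem_union_left _ (Finset.mem_image.2 ⟨⟨v, huv⟩, Finset.mem_univ _, rfl⟩)
  have hcard : (G.neighborSet x).ncard = Fintype.card (G.neighborSet x) := by
    rw [Set.ncard_eq_toFinset_card', Set.toFinset_card]
  have h1 := (Finset.card_le_card h).trans (Finset.card_union_le _ _)
  have h2 := Finset.card_image_le (s := Finset.univ) (f := G.dartOfNeighborSet x)
  have h3 := Finset.card_image_le (s := Finset.univ)
    (f := fun v => (G.dartOfNeighborSet x v).symm)
  rw [Finset.card_univ] at h2 h3
  omega

theorem isCompleteHomogeneous_one [G.LocallyFinite] (hG : G.Connected) {D : ℕ}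
    (hD : ∀ x, (G.neighborSet x).ncard ≤ D) : IsCompleteHomogeneous (Weights.one G) := by
  classical
  obtain ⟨B, hmono, hex, hstep⟩ := hG.exists_exhaustion
  let χ : ℕ → V → ℝ := fun n v => if v ∈ B n then 1 else 0
  have h0 : ∀ n v, 0 ≤ χ n v := fun n v => by simp only [χ]; split_ifs <;> norm_num
  have h1 : ∀ n v, χ n v ≤ 1 := fun n v => by simp only [χ]; split_ifs <;> norm_num
  have heq : ∀ n, ∀ v ∈ B n, χ n v = 1 := fun n v hv => if_pos hv
  -- An edge meeting `B p` has both ends in `B (p + 1)`, whence `n₀ = p + 1`. The `+ 1` in the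
  -- constant keeps it positive when `D = 0`.
  refine ⟨B, χ, ⟨hmono, hex, fun n => ?_, h0, h1, heq, fun p => ⟨p + 1, fun n hn e he => ?_⟩⟩,
    2 * D + 1, by positivity, fun n x => ?_⟩
  · exact (B n).finite_toSet.subset fun v hv => by
      by_contra h
      exact hv (if_neg h)
  · have hfst : e.fst ∈ B (p + 1) := he.elim (fun h => hstep p _ _ h e.adj.symm)
      fun h => hmono p.le_succ h
    have hsnd : e.snd ∈ B (p + 1) := he.elim (fun h => hmono p.le_succ h)
      fun h => hstep p _ _ h e.adj
    rw [diff, heq n _ (hmono hn hfst), heq n _ (hmono hn hsnd), sub_self]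
  · have hle : ∀ e ∈ (finite_darts_at (G := G) x).toFinset,
        (Weights.one G).r e * diff (χ n) e ^ 2 ≤ 1 := fun e _ => by
      have := h0 n e.fst
      have := h0 n e.snd
      have := h1 n e.fst
      have := h1 n e.snd
      simp only [Weights.one, diff, one_mul]
      exact (sq_le_one_iff_abs_le_one _).2 (abs_le.2 ⟨by linarith, by linarith⟩)
    have hsum := Finset.sum_le_card_nsmul _ _ _ hle
    have hc : ((finite_darts_at (G := G) x).toFinset.card : ℝ) ≤ 2 * D := by
      exact_mod_cast (card_darts_at_le x).trans (Nat.mul_le_mul_left 2 (hD x))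
    simp only [nsmul_eq_mul, mul_one] at hsum
    change 1 / (1 : ℝ) * _ ≤ _
    rw [div_one, one_mul]
    linarith

/-! ### Closedness of the range -/

/-- The isometry of a weighted `ℓ²` space with `lp` given by multiplication by `√w`. -/
noncomputable def L2.toLp {α : Type*} (w : α → ℝ) (hw : ∀ a, 0 < w a) :
    L2 w hw ≃ₗᵢ[ℝ] lp (fun _ : α => ℝ) 2 where
  toFun f := ⟨fun a => √(w a) * f a, memℓp_gen <| f.summable_sq.congr fun a => by
    simp [mul_pow, Real.sq_sqrt (hw a).le]⟩
  invFun g := ⟨fun a => (√(w a))⁻¹ * g a, by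
    have h := (lp.memℓp g).summable (by simp)
    refine h.congr fun a => ?_
    have := (hw a).ne'
    simp only [mul_pow, inv_pow, Real.sq_sqrt (hw a).le, ENNReal.toReal_ofNat, Real.norm_eq_abs,
      Real.rpow_ofNat, sq_abs]
    field_simp⟩
  left_inv f := by
    ext a
    exact inv_mul_cancel_left₀ (Real.sqrt_pos.2 (hw a)).ne' _
  right_inv g := by
    ext a
    exact mul_inv_cancel_left₀ (Real.sqrt_pos.2 (hw a)).ne' _
  map_add' f g := by
    ext a
    exact mul_add _ _ _
  map_smul' t f := by
    ext a
    exact mul_left_comm _ _ _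
  norm_map' f := by
    refine (sq_eq_sq₀ (norm_nonneg _) (norm_nonneg _)).1 ?_
    have h := lp.norm_rpow_eq_tsum (p := 2) (by simp) (E := fun _ : α => ℝ)
      ⟨fun a => √(w a) * f a, memℓp_gen <| f.summable_sq.congr fun a => by
        simp [mul_pow, Real.sq_sqrt (hw a).le]⟩
    simp only [ENNReal.toReal_ofNat, Real.rpow_ofNat, Real.norm_eq_abs, sq_abs] at h
    rw [L2.norm_sq_eq]
    refine h.trans (tsum_congr fun a => ?_)
    rw [mul_pow, Real.sq_sqrt (hw a).le]

instance {α : Type*} (w : α → ℝ) (hw : ∀ a, 0 < w a) : CompleteSpace (L2 w hw) :=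
  (L2.toLp w hw).toIsometryEquiv.completeSpace_iff.2 inferInstance

instance (W : Weights G) : CompleteSpace (L2E W) := by
  have h : IsClosed (L2E W : Set (L2Dart W)) := by
    change IsClosed {φ : L2Dart W | ∀ e : G.Dart, φ e.symm = -φ e}
    simp only [Set.ofPred_forall]
    exact isClosed_iInter fun e => isClosed_eq (L2.continuous_apply _) (L2.continuous_apply _).neg
  exact h.completeSpace_coe

/-- Evaluations are continuous on `L2`, so this pointwise relation is closed and passes from the
graph of `d` to its closure. -/
theorem dMin_apply [G.LocallyFinite] (W : Weights G) (f : (dMin W).domain) (e : G.Dart) :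
    (dMin W f : L2Dart W) e = f.1 e.snd - f.1 e.fst := by
  have hcl : IsClosed {p : L2V W × L2E W |
      ∀ e : G.Dart, (p.2 : L2Dart W) e = p.1 e.snd - p.1 e.fst} := by
    simp only [Set.ofPred_forall]
    refine isClosed_iInter fun e => isClosed_eq ?_ ?_
    · exact (L2.continuous_apply e).comp (continuous_subtype_val.comp continuous_snd)
    · exact ((L2.continuous_apply _).comp continuous_fst).sub
        ((L2.continuous_apply _).comp continuous_fst)
  have hmem : ((f : L2V W), dMin W f) ∈ (d W).graph.topologicalClosure := by
    rw [(d_isClosable W).graph_closure_eq_closure_graph]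
    exact (dMin W).mem_graph f
  exact closure_minimal (s := ((d W).graph : Set (L2V W × L2E W))) (fun q hq => by
    obtain ⟨f, h1, h2⟩ := (LinearPMap.mem_graph_iff _).1 hq
    intro e
    rw [← h1, ← h2]
    rfl) hcl hmem e

/-- The range of the closure of `d` is closed as soon as `d` is bounded below on the functions
vanishing on some finite set of vertices. -/
theorem isClosed_range_dMin [G.LocallyFinite] (W : Weights G) {F : Set V} (hF : F.Finite) {C : ℝ}
    (hC : ∀ f : (dMin W).domain, (∀ v ∈ F, f.1 v = 0) → ‖(f : L2V W)‖ ≤ C * ‖dMin W f‖) :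
    IsClosed (Set.range (dMin W)) := by
  have : Finite F := hF
  let ev : L2V W →L[ℝ] (F → ℝ) :=
    { toFun := fun f v => f v
      map_add' := fun _ _ => rfl
      map_smul' := fun _ _ => rfl
      cont := continuous_pi fun v => L2.continuous_apply (v : V) }
  exact (d_isClosable W).closure_isClosed.isClosed_range_of_norm_le ev fun f hf =>
    hC f fun v hv => congrFun hf ⟨v, hv⟩

/-- If every vertex outside `F` has two children, all of them distinct, then `d` is bounded below on
the functions vanishing on `F`. -/
theorem norm_le_of_children {F : Set V} (c : V → Bool → V) (hadj : ∀ u ∉ F, ∀ b, G.Adj u (c u b))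
    (hinj : ∀ u ∉ F, ∀ v ∉ F, ∀ a b, c u a = c v b → u = v ∧ a = b)
    (f : L2V (Weights.one G)) (φ : L2E (Weights.one G)) (hf : ∀ v ∈ F, f v = 0)
    (hφ : ∀ e : G.Dart, (φ : L2Dart (Weights.one G)) e = f e.snd - f e.fst) :
    ‖f‖ ≤ 4 * ‖φ‖ := by
  let φ' : L2Dart (Weights.one G) := φ
  have hsf : Summable fun v => f v ^ 2 := f.summable_sq.congr fun v => one_mul _
  have hsφ : Summable fun e => φ' e ^ 2 := (φ'.summable_sq.mul_left 2).congr fun e => by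
    simp only [Weights.one]
    ring
  have hnf : ‖f‖ ^ 2 = ∑' v, f v ^ 2 :=
    (L2.norm_sq_eq f).trans (tsum_congr fun v => one_mul _)
  have hnφ : 2 * ‖φ‖ ^ 2 = ∑' e, φ' e ^ 2 := by
    rw [show ‖φ‖ = ‖φ'‖ from rfl, L2.norm_sq_eq, ← tsum_mul_left]
    refine tsum_congr fun e => ?_
    simp only [Weights.one]
    ring
  let U := {u : V // u ∉ F}
  let i : U × Bool → V := fun p => c p.1 p.2
  let j : U × Bool → G.Dart := fun p => ⟨(p.1, c p.1 p.2), hadj p.1 p.1.2 p.2⟩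
  have hi : Function.Injective i := fun p q h => by
    obtain ⟨h1, h2⟩ := hinj p.1 p.1.2 q.1 q.1.2 _ _ h
    exact Prod.ext (Subtype.ext h1) h2
  have hj : Function.Injective j := fun p q h => hi (congrArg (fun e : G.Dart => e.snd) h)
  have hsU : Summable fun u : U => f u ^ 2 :=
    hsf.comp_injective (i := fun u : U => (u : V)) Subtype.val_injective
  have hU : ∑' u : U, f u ^ 2 = ∑' v, f v ^ 2 := by
    refine Function.Injective.tsum_eq (f := fun v => f v ^ 2) (g := fun u : U => (u : V))
      Subtype.val_injective fun v hv => ?_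
    exact ⟨⟨v, fun h => hv (by simp [hf v h])⟩, rfl⟩
  have hsp : Summable fun p : U × Bool => f p.1 ^ 2 := by
    refine (summable_prod_of_nonneg fun p => sq_nonneg _).2 ⟨fun u => .of_finite, ?_⟩
    simp only [tsum_fintype, Fintype.sum_bool]
    exact hsU.add hsU
  have hp : ∑' p : U × Bool, f p.1 ^ 2 = 2 * ‖f‖ ^ 2 := by
    rw [hsp.tsum_prod, hnf, ← hU, ← tsum_mul_left]
    refine tsum_congr fun u => ?_
    simp only [tsum_fintype, Fintype.sum_bool]
    ring
  have hsi : Summable fun p => f (i p) ^ 2 := hsf.comp_injective (i := i) hi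
  have hsj : Summable fun p => φ' (j p) ^ 2 := hsφ.comp_injective (i := j) hj
  have h1 : ∑' p, f (i p) ^ 2 ≤ ‖f‖ ^ 2 := by
    rw [hnf]
    exact tsum_comp_le_tsum_of_inj hsf (fun _ => sq_nonneg _) hi
  have h2 : ∑' p, φ' (j p) ^ 2 ≤ 2 * ‖φ‖ ^ 2 := by
    rw [hnφ]
    exact tsum_comp_le_tsum_of_inj hsφ (fun _ => sq_nonneg _) hj
  have h3 : ∑' p : U × Bool, f p.1 ^ 2 ≤
      ∑' p, (3 / 2 * f (i p) ^ 2 + 3 * φ' (j p) ^ 2) := by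
    refine hsp.tsum_le_tsum (fun p => ?_) ((hsi.mul_left _).add (hsj.mul_left _))
    have he : φ' (j p) = f (i p) - f p.1 := hφ (j p)
    rw [he]
    -- With `a = f p.1` and `x = f (i p) - a`, the right side minus the left is exactly `(a + 3x)² /
    -- 2`. The coefficient `3/2` is below the number `2` of children, so it can be absorbed.
    nlinarith [sq_nonneg (f p.1 + 3 * (f (i p) - f p.1))]
  rw [(hsi.mul_left _).tsum_add (hsj.mul_left _), tsum_mul_left, tsum_mul_left, hp] at h3
  refine abs_le_of_sq_le_sq' ?_ (by positivity) |>.2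
  -- Here `2‖f‖² ≤ (3/2)‖f‖² + 6‖φ‖²`, so `‖f‖² ≤ 12‖φ‖² ≤ (4‖φ‖)²`.
  nlinarith [sq_nonneg ‖φ‖]

/-! ### The ends of the graph -/

/-- If the complementary graph of `K₀` is the union of disjoint subgraphs, a vertex that is neither
in `K₀` nor adjacent to `K₀` lies in one of them, together with all edges at this vertex. -/
theorem exists_neighborSet_eq {K₀ : G.Subgraph} {ι : Type*} {T : ι → G.Subgraph}
    (hdisj : ∀ i j, i ≠ j → Disjoint (T i).verts (T j).verts)
    (hT : complementary K₀ = ⨆ i, T i) {u : V}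
    (hu : u ∉ K₀.verts ∪ ⋃ x ∈ K₀.verts, G.neighborSet x) :
    ∃ i, u ∈ (T i).verts ∧ (T i).neighborSet u = G.neighborSet u := by
  simp only [Set.mem_union, Set.mem_iUnion, SimpleGraph.mem_neighborSet, exists_prop, not_or,
    not_exists, not_and] at hu
  have hmem : u ∈ (complementary K₀).verts := hu.1
  rw [hT, SimpleGraph.Subgraph.verts_iSup, Set.mem_iUnion] at hmem
  obtain ⟨i, hi⟩ := hmem
  refine ⟨i, hi, Set.Subset.antisymm (fun v h => h.adj_sub) fun v huv => ?_⟩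
  have hadj : (complementary K₀).Adj u v :=
    ⟨huv, fun h => hu.1 h.fst_mem, hu.1, fun h => hu.2 v h huv.symm⟩
  rw [hT, SimpleGraph.Subgraph.iSup_adj] at hadj
  obtain ⟨j, hj⟩ := hadj
  -- The edge lies in `T j`, which therefore contains `u`; disjointness leaves only `T i`.
  have hij : i = j := by
    by_contra h
    exact Set.disjoint_left.1 (hdisj i j h) hi hj.fst_mem
  subst hij
  exact hj

theorem exists_ncard_le [G.LocallyFinite] {F : Set V} (hF : F.Finite) {D : ℕ}
    (hD : ∀ u ∉ F, (G.neighborSet u).ncard ≤ D) : ∃ D', ∀ u, (G.neighborSet u).ncard ≤ D' := by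
  obtain ⟨M, hM⟩ := (hF.image fun u => (G.neighborSet u).ncard).bddAbove
  refine ⟨max M D, fun u => ?_⟩
  by_cases hu : u ∈ F
  · exact le_max_of_le_left (hM ⟨u, hu, rfl⟩)
  · exact le_max_of_le_right (hD u hu)

/-- The vertices of trees contained with all their edges in `G` have children. -/
theorem exists_children {ι : Type*} {T : ι → G.Subgraph} {F : Set V}
    (hdisj : ∀ i j, i ≠ j → Disjoint (T i).verts (T j).verts)
    (htree : ∀ i, (T i).coe.IsTree)
    (hF : ∀ u ∉ F, ∃ i, u ∈ (T i).verts ∧ 3 ≤ ((T i).neighborSet u).ncard) :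
    ∃ c : V → Bool → V, (∀ u ∉ F, ∀ b, G.Adj u (c u b)) ∧
      ∀ u ∉ F, ∀ v ∉ F, ∀ a b, c u a = c v b → u = v ∧ a = b := by
  have hcard : ∀ i (u : (T i).verts),
      ((T i).coe.neighborSet u).ncard = ((T i).neighborSet u).ncard := fun i u => by
    rw [← Set.ncard_image_of_injective _ Subtype.val_injective]
    congr 1
    ext v
    constructor
    · rintro ⟨w, hw, rfl⟩
      exact hw
    · exact fun hv => ⟨⟨v, hv.snd_mem⟩, hv, rfl⟩
  choose c hc1 hc2 using fun i => (htree i).exists_children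
  have key : ∀ u, ∃ c' : Bool → V, u ∉ F → ∃ i, ∃ h : u ∈ (T i).verts,
      3 ≤ ((T i).coe.neighborSet ⟨u, h⟩).ncard ∧ ∀ b, c' b = c i ⟨u, h⟩ b := by
    intro u
    by_cases hu : u ∈ F
    · exact ⟨fun _ => u, fun h => absurd hu h⟩
    · obtain ⟨i, h, h3⟩ := hF u hu
      exact ⟨fun b => c i ⟨u, h⟩ b, fun _ => ⟨i, h, by rwa [hcard], fun _ => rfl⟩⟩
  choose c' hc' using key
  refine ⟨c', fun u hu b => ?_, fun u hu v hv a b hab => ?_⟩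
  · obtain ⟨i, h, h3, he⟩ := hc' u hu
    rw [he]
    exact ((hc1 i _ h3).1 b).adj_sub
  · obtain ⟨i, hi, hi3, hie⟩ := hc' u hu
    obtain ⟨j, hj, hj3, hje⟩ := hc' v hv
    rw [hie, hje] at hab
    -- Children stay in the tree of their parent, so a common child forces a common tree.
    have hij : i = j := by
      by_contra h
      exact Set.disjoint_left.1 (hdisj i j h) (c i ⟨u, hi⟩ a).2 (hab ▸ (c j ⟨v, hj⟩ b).2)
    subst hij
    have hab' := Subtype.ext hab
    have huv := hc2 i _ _ a b hi3 hj3 hab'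
    have huv' : u = v := congrArg Subtype.val huv
    subst huv'
    refine ⟨rfl, ?_⟩
    have hne := (hc1 i _ hi3).2
    cases a <;> cases b
    · rfl
    · exact absurd hab'.symm hne
    · exact absurd hab' hne
    · rfl

end WeightedGraph

theorem mainTheorem5 {V : Type*} (G : SimpleGraph V) [G.LocallyFinite] (hconn : G.Connected)
    (K₀ : G.Subgraph) (hfin : K₀.verts.Finite)
    (htrees : WeightedGraph.IsFiniteUnionOfTrees (WeightedGraph.complementary K₀)) :
    WeightedGraph.IsCompleteHomogeneous (WeightedGraph.Weights.one G) ∧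
      IsClosed (Set.range (WeightedGraph.dMin (WeightedGraph.Weights.one G))) := by
  obtain ⟨k, T, hdisj, hT, hunion⟩ := htrees
  choose htree q hq3 hq using hT
  -- Neighbours of `K₀` are included because their valence in the tree may be smaller than in `G`.
  let F : Set V := K₀.verts ∪ ⋃ x ∈ K₀.verts, G.neighborSet x
  have hF : F.Finite := hfin.union (hfin.biUnion fun x _ => Set.toFinite _)
  have hends : ∀ u ∉ F, ∃ i, u ∈ (T i).verts ∧ ((T i).neighborSet u).ncard = q i ∧
      (G.neighborSet u).ncard = q i := fun u hu => by
    obtain ⟨i, hi, heq⟩ := WeightedGraph.exists_neighborSet_eq hdisj hunion hu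
    refine ⟨i, hi, ?_⟩
    rcases hq i with h | h
    · exact ⟨h u hi, heq ▸ h u hi⟩
    · exact ⟨heq ▸ h u hi, h u hi⟩
  constructor
  · obtain ⟨D, hD⟩ := WeightedGraph.exists_ncard_le hF (D := Finset.univ.sup q) fun u hu => by
      obtain ⟨i, -, -, h⟩ := hends u hu
      exact h.le.trans (Finset.le_sup (Finset.mem_univ i))
    exact WeightedGraph.isCompleteHomogeneous_one hconn hD
  · obtain ⟨c, hadj, hinj⟩ := WeightedGraph.exists_children hdisj htree (F := F) fun u hu => by
      obtain ⟨i, hi, h, -⟩ := hends u hu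
      exact ⟨i, hi, h ▸ hq3 i⟩
    exact WeightedGraph.isClosed_range_dMin _ hF fun f hf =>
      WeightedGraph.norm_le_of_children c hadj hinj f.1 _ hf (WeightedGraph.dMin_apply _ f)
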